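/- Let $n>1$ be an integer. Let $W(n)_{>0}$ be the space of real $n\times n$ matrices $B$ with $\det(B)>0$ all of whose columns are unit vectors in the Euclidean norm, with the topology of a subspace of the space of matrices. Let $G_0$ be the finite group of signed permutation matrices of determinant $1$, that is, of the matrices of determinant $1$ of the form $a\sigma$ with $a$ a diagonal matrix with diagonal entries $\pm1$ and $\sigma$ an $n\times n$ permutation matrix. The group $G_0$ acts on $W(n)_{>0}$ by matrix multiplication from the right; let $W(n)_{>0}/G_0$ be the orbit space with the quotient topology. Then there is an isomorphism of graded $\mathbb{Q}$-algebras $$H^*(W(n)_{>0}/G_0;\mathbb{Q})\simeq H^*(SO(n);\mathbb{Q}),$$ where $H^*(\,\cdot\,;\mathbb{Q})$ denotes singular cohomology with rational coefficients and the cup product, that is, there are $\mathbb{Q}$-linear isomorphisms $H^k(W(n)_{>0}/G_0;\mathbb{Q})\to H^k(SO(n);\mathbb{Q})$ for all $k\ge 0$ that together preserve the unit and the cup product. -/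

import Mathlib

open CategoryTheory

noncomputable section

namespace SingularCohomology

section SimplicialCochains

variable (R : Type) [CommRing R] (S : SSet.{0})

/-- `R`-valued `k`-cochains of a simplicial set. -/
abbrev Cochain (k : ℕ) : Type := S.obj (Opposite.op (SimplexCategory.mk k)) → R

/-- The coboundary `(dφ)(σ) = ∑ i, (-1)^i φ(∂ᵢσ)`. -/
def d (k : ℕ) : Cochain R S k →ₗ[R] Cochain R S (k + 1) where
  toFun φ := fun σ => ∑ i : Fin (k + 2), (-1 : R) ^ (i : ℕ) * φ (S.map (SimplexCategory.δ i).op σ)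
  map_add' φ ψ := by
    funext σ
    simp [mul_add, Finset.sum_add_distrib]
  map_smul' c φ := by
    funext σ
    simp [Finset.mul_sum, mul_left_comm]

/-- The `k`-cocycles. -/
def cocycles (k : ℕ) : Submodule R (Cochain R S k) := LinearMap.ker (d R S k)

/-- The `k`-coboundaries; in degree `0` only the zero cochain. -/
def coboundaries : (k : ℕ) → Submodule R (Cochain R S k)
  | 0 => ⊥
  | k + 1 => LinearMap.range (d R S k)

/-- Cocycles modulo coboundaries. -/
abbrev SCohomology (k : ℕ) : Type :=
  cocycles R S k ⧸ (coboundaries R S k).submoduleOf (cocycles R S k)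

variable {R S}

/-- The cup product of cochains: `φ` on the front `p`-face (vertices `0, …, p`) times `ψ` on the
back `q`-face (vertices `p, …, p + q`). -/
def cochainCup {p q n : ℕ} (h : p + q = n) (φ : Cochain R S p) (ψ : Cochain R S q) :
    Cochain R S n := fun σ =>
  φ (S.map (SimplexCategory.subinterval 0 p (by omega)).op σ) *
    ψ (S.map (SimplexCategory.subinterval p q h.le).op σ)

theorem subinterval_δ_of_lt {n a l : ℕ} (h : a + l ≤ n) (j : Fin (n + 2)) (hj : a + l < (j : ℕ)) :
    SimplexCategory.subinterval a l h ≫ SimplexCategory.δ j =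
      SimplexCategory.subinterval a l (by omega) := by
  ext x
  change (j.succAbove ⟨x.1 + a, _⟩ : ℕ) = x.1 + a
  have hx : x.1 < l + 1 := x.2
  simp only [Fin.succAbove, Fin.lt_def, Fin.val_castSucc]
  split_ifs <;> simp <;> omega

theorem subinterval_δ_of_ge {n a l : ℕ} (h : a + l ≤ n) (j : Fin (n + 2)) (hj : (j : ℕ) ≤ a) :
    SimplexCategory.subinterval a l h ≫ SimplexCategory.δ j =
      SimplexCategory.subinterval (a + 1) l (by omega) := by
  ext x
  change (j.succAbove ⟨x.1 + a, _⟩ : ℕ) = x.1 + (a + 1)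
  have hx : x.1 < l + 1 := x.2
  simp only [Fin.succAbove, Fin.lt_def, Fin.val_castSucc]
  split_ifs <;> simp <;> omega

theorem subinterval_δ_shift {n a l : ℕ} (h : a + l ≤ n) (i : Fin (l + 2)) (j : Fin (n + 2))
    (hij : (j : ℕ) = a + i) :
    SimplexCategory.subinterval a l h ≫ SimplexCategory.δ j =
      SimplexCategory.δ i ≫ SimplexCategory.subinterval a (l + 1) (by omega) := by
  ext x
  change (j.succAbove ⟨x.1 + a, _⟩ : ℕ) = (i.succAbove x : ℕ) + a
  have hx : x.1 < l + 1 := x.2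
  simp only [Fin.succAbove, Fin.lt_def, Fin.val_castSucc]
  split_ifs <;> simp <;> omega

/-- The Leibniz rule `d(φ ⌣ ψ) = dφ ⌣ ψ + (-1)^p φ ⌣ dψ`. -/
theorem d_cochainCup {p q n : ℕ} (h : p + q = n) (φ : Cochain R S p) (ψ : Cochain R S q) :
    d R S n (cochainCup h φ ψ) =
      cochainCup (by omega) (d R S p φ) ψ +
        (-1 : R) ^ p • cochainCup (by omega) φ (d R S q ψ) := by
  subst h
  funext σ
  have key : ∀ f : Fin (p + q + 2) → R, ∑ i, f i =
      ∑ i : Fin (p + 1), f ⟨i, by omega⟩ + ∑ i : Fin (q + 1), f ⟨p + 1 + i, by omega⟩ := by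
    intro f
    have e : p + 1 + (q + 1) = p + q + 2 := by omega
    rw [← Equiv.sum_comp (finCongr e) f, Fin.sum_univ_add]
    rfl
  have mm : ∀ {a b c : ℕ} (f : SimplexCategory.mk a ⟶ SimplexCategory.mk b)
      (g : SimplexCategory.mk b ⟶ SimplexCategory.mk c) (τ : S.obj (Opposite.op (.mk c))),
      S.map f.op (S.map g.op τ) = S.map (f ≫ g).op τ := by
    intro a b c f g τ
    simp
  simp only [d, LinearMap.coe_mk, AddHom.coe_mk, cochainCup, Pi.add_apply, Pi.smul_apply,
    smul_eq_mul, mm]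
  rw [key, Fin.sum_univ_castSucc (n := p + 1), Fin.sum_univ_succ (n := q + 1)]
  have h1 : ∀ i : Fin (p + 1),
      SimplexCategory.subinterval 0 p (by omega) ≫
        SimplexCategory.δ (⟨i, by omega⟩ : Fin (p + q + 2)) =
      SimplexCategory.δ i.castSucc ≫ SimplexCategory.subinterval 0 (p + 1) (by omega) :=
    fun i => subinterval_δ_shift (by omega) _ _ (by simp)
  have h2 : ∀ i : Fin (p + 1),
      SimplexCategory.subinterval p q le_rfl ≫
        SimplexCategory.δ (⟨i, by omega⟩ : Fin (p + q + 2)) =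
      SimplexCategory.subinterval (p + 1) q (by omega) :=
    fun i => subinterval_δ_of_ge _ _ (by simp; omega)
  have h3 : ∀ i : Fin (q + 1),
      SimplexCategory.subinterval 0 p (by omega) ≫
        SimplexCategory.δ (⟨p + 1 + i, by omega⟩ : Fin (p + q + 2)) =
      SimplexCategory.subinterval 0 p (by omega) :=
    fun i => subinterval_δ_of_lt _ _ (by simp; omega)
  have h4 : ∀ i : Fin (q + 1),
      SimplexCategory.subinterval p q le_rfl ≫
        SimplexCategory.δ (⟨p + 1 + i, by omega⟩ : Fin (p + q + 2)) =
      SimplexCategory.δ i.succ ≫ SimplexCategory.subinterval p (q + 1) (by omega) :=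
    fun i => subinterval_δ_shift _ _ _ (by simp; omega)
  have h5 : SimplexCategory.δ (Fin.last (p + 1)) ≫
        SimplexCategory.subinterval 0 (p + 1) (by omega) =
      SimplexCategory.subinterval (n := p + q + 1) 0 p (by omega) := by
    rw [← subinterval_δ_shift (n := p + q) (by omega) (Fin.last (p + 1)) ⟨p + 1, by omega⟩
      (by simp)]
    exact subinterval_δ_of_lt _ _ (by simp)
  have h6 : SimplexCategory.δ (0 : Fin (q + 2)) ≫
        SimplexCategory.subinterval p (q + 1) (by omega) =
      SimplexCategory.subinterval (n := p + q + 1) (p + 1) q (by omega) := by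
    rw [← subinterval_δ_shift (n := p + q) (by omega) (0 : Fin (q + 2)) ⟨p, by omega⟩
      (by simp)]
    exact subinterval_δ_of_ge _ _ (by simp)
  simp only [h1, h2, h3, h4, h5, h6, add_mul, mul_add, Finset.sum_mul, Finset.mul_sum,
    Fin.val_castSucc, Fin.val_last, Fin.val_zero, Fin.val_succ]
  have e1 : ∀ i : Fin (q + 1), (-1 : R) ^ (p + 1 + (i : ℕ)) = (-1) ^ p * (-1) ^ ((i : ℕ) + 1) :=
    fun i => by ring
  simp only [e1]
  have e2 : (-1 : R) ^ (p + 1) = - (-1) ^ p := by ring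
  rw [e2]
  simp only [pow_zero, one_mul, neg_mul, mul_assoc, mul_left_comm (φ _)]
  ring

theorem cochainCup_mem_cocycles {p q n : ℕ} (h : p + q = n) {φ : Cochain R S p}
    {ψ : Cochain R S q} (hφ : φ ∈ cocycles R S p) (hψ : ψ ∈ cocycles R S q) :
    cochainCup h φ ψ ∈ cocycles R S n := by
  have hφ' : d R S p φ = 0 := hφ
  have hψ' : d R S q ψ = 0 := hψ
  change d R S n _ = 0
  rw [d_cochainCup, hφ', hψ']
  funext σ
  simp [cochainCup]

theorem cochainCup_mem_coboundaries_left {p q n : ℕ} (h : p + q = n) {φ : Cochain R S p}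
    {ψ : Cochain R S q} (hφ : φ ∈ coboundaries R S p) (hψ : ψ ∈ cocycles R S q) :
    cochainCup h φ ψ ∈ coboundaries R S n := by
  have hψ' : d R S q ψ = 0 := hψ
  cases p with
  | zero =>
    have h0 : φ = 0 := by simpa [coboundaries] using hφ
    have : cochainCup h φ ψ = 0 := by
      funext σ
      simp [cochainCup, h0]
    rw [this]
    exact zero_mem _
  | succ p =>
    obtain ⟨θ, rfl⟩ := hφ
    obtain ⟨m, rfl⟩ : ∃ m, n = m + 1 := ⟨p + q, by omega⟩
    refine ⟨cochainCup (by omega) θ ψ, ?_⟩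
    rw [d_cochainCup, hψ']
    funext σ
    simp [cochainCup]

theorem cochainCup_mem_coboundaries_right {p q n : ℕ} (h : p + q = n) {φ : Cochain R S p}
    {ψ : Cochain R S q} (hφ : φ ∈ cocycles R S p) (hψ : ψ ∈ coboundaries R S q) :
    cochainCup h φ ψ ∈ coboundaries R S n := by
  have hφ' : d R S p φ = 0 := hφ
  cases q with
  | zero =>
    have h0 : ψ = 0 := by simpa [coboundaries] using hψ
    have : cochainCup h φ ψ = 0 := by
      funext σ
      simp [cochainCup, h0]
    rw [this]
    exact zero_mem _
  | succ q =>
    obtain ⟨θ, rfl⟩ := hψ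
    obtain ⟨m, rfl⟩ : ∃ m, n = m + 1 := ⟨p + q, by omega⟩
    refine ⟨(-1 : R) ^ p • cochainCup (by omega) φ θ, ?_⟩
    rw [map_smul, d_cochainCup, hφ', smul_add, smul_smul, ← mul_pow]
    funext σ
    simp [cochainCup]

/-- The cup product on cohomology, induced by the cup product of cocycles. -/
def cup {p q : ℕ} : SCohomology R S p → SCohomology R S q → SCohomology R S (p + q) :=
  Quotient.map₂
    (fun φ ψ => ⟨cochainCup rfl φ.1 ψ.1, cochainCup_mem_cocycles rfl φ.2 ψ.2⟩) (by
      intro φ φ' hφ ψ ψ' hψ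
      have h1 : (φ - φ' : Cochain R S p) ∈ coboundaries R S p :=
        (Submodule.quotientRel_def ((coboundaries R S p).submoduleOf (cocycles R S p))).1 hφ
      have h2 : (ψ - ψ' : Cochain R S q) ∈ coboundaries R S q :=
        (Submodule.quotientRel_def ((coboundaries R S q).submoduleOf (cocycles R S q))).1 hψ
      refine (Submodule.quotientRel_def _).2 ?_
      change cochainCup rfl φ.1 ψ.1 - cochainCup rfl φ'.1 ψ'.1 ∈ coboundaries R S (p + q)
      have e : cochainCup rfl φ.1 ψ.1 - cochainCup rfl φ'.1 ψ'.1 =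
          cochainCup rfl (φ.1 - φ'.1) ψ.1 + cochainCup rfl φ'.1 (ψ.1 - ψ'.1) := by
        funext σ
        simp only [cochainCup, Pi.add_apply, Pi.sub_apply]
        ring
      rw [e]
      exact add_mem (cochainCup_mem_coboundaries_left rfl h1 ψ.2)
        (cochainCup_mem_coboundaries_right rfl φ'.2 h2))

variable (R S)

/-- The unit of the cohomology algebra: the class of the constant `0`-cochain `1`. -/
def unit : SCohomology R S 0 :=
  Submodule.Quotient.mk ⟨fun _ => 1, by
    change d R S 0 _ = 0
    funext σ
    simp [d, Fin.sum_univ_two]⟩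

end SimplicialCochains

/-- Singular cohomology `H^k(X; ℚ)`: the cohomology of the rational cochains on the singular
simplicial set of `X`, whose `k`-simplices are the continuous maps from the standard topological
`k`-simplex to `X`. -/
abbrev RatCohomology (X : Type) [TopologicalSpace X] (k : ℕ) : Type :=
  SCohomology ℚ (TopCat.toSSet.obj (TopCat.of X)) k

end SingularCohomology

namespace UnitColumns

/-- `W(n)`: real `n × n` matrices all of whose columns have Euclidean length one. -/
def W (n : ℕ) : Set (Matrix (Fin n) (Fin n) ℝ) :=
  {B | ∀ j, ‖WithLp.toLp 2 (B.col j)‖ = 1}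

/-- `W(n)_{>0}`, with the subspace topology of the space of matrices. -/
abbrev WPos (n : ℕ) : Type := {B : Matrix (Fin n) (Fin n) ℝ // B ∈ W n ∧ 0 < B.det}

/-- The matrix `aσ`, with `a` diagonal with entries `±1` and `σ` a permutation matrix. -/
def signedPerm {n : ℕ} (a : Fin n → ℤˣ) (σ : Equiv.Perm (Fin n)) : Matrix (Fin n) (Fin n) ℝ :=
  Matrix.diagonal (fun i => ((a i : ℤ) : ℝ)) * σ.permMatrix ℝ

theorem signedPerm_apply {n : ℕ} (a : Fin n → ℤˣ) (σ : Equiv.Perm (Fin n)) (i j : Fin n) :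
    signedPerm a σ i j = if σ i = j then ((a i : ℤ) : ℝ) else 0 := by
  simp [signedPerm, Matrix.diagonal_mul, Equiv.Perm.permMatrix, PEquiv.toMatrix_apply,
    eq_comm]

theorem signedPerm_mul {n : ℕ} (a b : Fin n → ℤˣ) (σ τ : Equiv.Perm (Fin n)) :
    signedPerm a σ * signedPerm b τ = signedPerm (fun i => a i * b (σ i)) (τ * σ) := by
  ext i j
  rw [Matrix.mul_apply, Finset.sum_eq_single (σ i)]
  · simp [signedPerm_apply]
  · intro x _ hx
    simp [signedPerm_apply, hx.symm]
  · simp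

theorem signedPerm_one {n : ℕ} : signedPerm (1 : Fin n → ℤˣ) 1 = 1 := by
  ext i j
  simp [signedPerm_apply, Matrix.one_apply]

/-- The group `G` of signed permutation matrices. -/
def G (n : ℕ) : Subgroup (GL (Fin n) ℝ) where
  carrier := {g | ∃ a σ, (g : Matrix (Fin n) (Fin n) ℝ) = signedPerm a σ}
  mul_mem' := by
    rintro g h ⟨a, σ, hg⟩ ⟨b, τ, hh⟩
    exact ⟨_, _, by rw [Units.val_mul, hg, hh, signedPerm_mul]⟩
  one_mem' := ⟨1, 1, by rw [signedPerm_one]; rfl⟩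
  inv_mem' := by
    rintro g ⟨a, σ, hg⟩
    refine ⟨fun i => a (σ⁻¹ i), σ⁻¹, ?_⟩
    refine Units.inv_eq_of_mul_eq_one_right ?_
    rw [hg, signedPerm_mul, ← signedPerm_one]
    congr 1
    · funext i
      simp
    · simp

/-- The subgroup `G₀ ⊆ G` of the elements of determinant one. -/
def G₀ (n : ℕ) : Subgroup (GL (Fin n) ℝ) := G n ⊓ (Matrix.GeneralLinearGroup.det).ker

theorem mul_mem_WPos {n : ℕ} {B : Matrix (Fin n) (Fin n) ℝ} (hB : B ∈ W n ∧ 0 < B.det)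
    {g : GL (Fin n) ℝ} (hg : g ∈ G₀ n) : B * g.1 ∈ W n ∧ 0 < (B * g.1).det := by
  obtain ⟨⟨a, σ, ha⟩, hdet⟩ := hg
  have hdet' : g.1.det = 1 := by
    simpa using congrArg Units.val (MonoidHom.mem_ker.1 hdet)
  refine ⟨fun j => ?_, by rw [Matrix.det_mul, hdet', mul_one]; exact hB.2⟩
  have hcol : WithLp.toLp 2 ((B * g.1).col j) =
      ((a (σ⁻¹ j) : ℤ) : ℝ) • WithLp.toLp 2 (B.col (σ⁻¹ j)) := by
    ext i
    simp only [ha, Matrix.col_apply, Matrix.mul_apply, signedPerm_apply, PiLp.smul_apply,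
      smul_eq_mul]
    rw [Finset.sum_eq_single (σ⁻¹ j)]
    · simp [mul_comm]
    · intro b _ hb
      rw [if_neg, mul_zero]
      rintro rfl
      simp at hb
    · simp
  rw [hcol, norm_smul, hB.1]
  rcases Int.units_eq_one_or (a (σ⁻¹ j)) with h | h <;> rw [h] <;> simp

/-- The right action of `G₀` on `W(n)_{>0}` by matrix multiplication `B ↦ B g`, as an action of
the opposite group. -/
instance (n : ℕ) : MulAction (G₀ n)ᵐᵒᵖ (WPos n) where
  smul g B := ⟨B.1 * g.unop.1.1, mul_mem_WPos B.2 g.unop.2⟩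
  one_smul B := Subtype.ext (Matrix.mul_one B.1)
  mul_smul g h B := Subtype.ext (Matrix.mul_assoc B.1 h.unop.1.1 g.unop.1.1).symm

/-- The orbit space `W(n)_{>0} / G₀`, with the quotient topology. -/
abbrev WPosQuot (n : ℕ) : Type := MulAction.orbitRel.Quotient (G₀ n)ᵐᵒᵖ (WPos n)

end UnitColumns

end

/-!
The inclusion `SO(n) → W(n)_{>0}` is a homotopy equivalence: Gram–Schmidt retracts `W(n)_{>0}` onto
`SO(n)`, and the straight line from `B` to its orthonormalisation `Q` keeps the determinant positive
(as `Qᵀ B` is upper triangular with positive diagonal), so that it can be pushed back into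
`W(n)_{>0}` by normalising the columns.

The finite group `G₀` acts freely, so `W(n)_{>0} → W(n)_{>0} / G₀` is a covering. Every `g ∈ G₀` is
joined to `1` by a path `γ` in `SO(n)` (it is a product of an even number of reflections, any two of
which are joined by a path of reflections), so right multiplication by `g` is homotopic to the
identity, again by normalising the columns of `B γ(t)`. Hence `G₀` acts trivially on the rational
cohomology of `W(n)_{>0}`, and averaging cochains over `G₀` (transfer) shows that the projection
induces an isomorphism. The composite `SO(n) → W(n)_{>0} → W(n)_{>0} / G₀` therefore induces the
required isomorphism, which preserves unit and cup product because it comes from a continuous map.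
-/

noncomputable section

namespace SingularCohomology

section Functoriality

variable {R : Type} [CommRing R] {S T U : SSet.{0}}

theorem mem_cocycles {k : ℕ} {φ : Cochain R S k} : φ ∈ cocycles R S k ↔ d R S k φ = 0 :=
  Iff.rfl

variable (R) in
/-- The pullback of cochains along a map of simplicial sets. -/
def cochainMap (f : S ⟶ T) (k : ℕ) : Cochain R T k →ₗ[R] Cochain R S k :=
  LinearMap.funLeft R R fun σ => f.app _ σ

theorem cochainMap_apply (f : S ⟶ T) (k : ℕ) (φ : Cochain R T k) (σ) :
    cochainMap R f k φ σ = φ (f.app _ σ) := rfl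

theorem d_cochainMap (f : S ⟶ T) (k : ℕ) (φ : Cochain R T k) :
    d R S k (cochainMap R f k φ) = cochainMap R f (k + 1) (d R T k φ) := by
  funext σ
  simp only [d, LinearMap.coe_mk, AddHom.coe_mk, cochainMap_apply, NatTrans.naturality_apply]

theorem cochainMap_mem_cocycles (f : S ⟶ T) {k : ℕ} {φ : Cochain R T k}
    (hφ : φ ∈ cocycles R T k) : cochainMap R f k φ ∈ cocycles R S k := by
  rw [mem_cocycles, d_cochainMap, mem_cocycles.1 hφ, map_zero]

theorem cochainMap_mem_coboundaries (f : S ⟶ T) :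
    ∀ {k : ℕ} {φ : Cochain R T k}, φ ∈ coboundaries R T k →
      cochainMap R f k φ ∈ coboundaries R S k
  | 0, φ, hφ => by rw [show φ = 0 from (Submodule.mem_bot R).1 hφ, map_zero]; exact zero_mem _
  | k + 1, _, ⟨θ, hθ⟩ => ⟨cochainMap R f k θ, by rw [d_cochainMap, hθ]⟩

/-- The cohomology class of a cocycle. -/
def cls {k : ℕ} (φ : Cochain R S k) (hφ : φ ∈ cocycles R S k) : SCohomology R S k :=
  Submodule.Quotient.mk ⟨φ, hφ⟩

theorem cls_eq_cls {k : ℕ} {φ ψ : Cochain R S k} (hφ : φ ∈ cocycles R S k)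
    (hψ : ψ ∈ cocycles R S k) : cls φ hφ = cls ψ hψ ↔ φ - ψ ∈ coboundaries R S k :=
  Submodule.Quotient.eq _

theorem cls_eq_zero {k : ℕ} {φ : Cochain R S k} (hφ : φ ∈ cocycles R S k) :
    cls φ hφ = 0 ↔ φ ∈ coboundaries R S k :=
  Submodule.Quotient.mk_eq_zero _

theorem exists_cls_eq {k : ℕ} (a : SCohomology R S k) :
    ∃ (φ : Cochain R S k) (hφ : φ ∈ cocycles R S k), cls φ hφ = a := by
  obtain ⟨⟨φ, hφ⟩, rfl⟩ := Submodule.Quotient.mk_surjective _ a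
  exact ⟨φ, hφ, rfl⟩

variable (R) in
/-- The map induced on cohomology by a map of simplicial sets. -/
def cohomologyMap (f : S ⟶ T) (k : ℕ) : SCohomology R T k →ₗ[R] SCohomology R S k :=
  Submodule.mapQ _ _ ((cochainMap R f k).restrict fun _ h => cochainMap_mem_cocycles f h)
    fun _ h => cochainMap_mem_coboundaries f h

theorem cohomologyMap_cls (f : S ⟶ T) {k : ℕ} {φ : Cochain R T k} (hφ : φ ∈ cocycles R T k) :
    cohomologyMap R f k (cls φ hφ) = cls (cochainMap R f k φ) (cochainMap_mem_cocycles f hφ) := rfl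

theorem cohomologyMap_id (k : ℕ) : cohomologyMap R (𝟙 S) k = LinearMap.id := by
  ext a
  rfl

theorem cohomologyMap_comp (f : S ⟶ T) (g : T ⟶ U) (k : ℕ) :
    cohomologyMap R (f ≫ g) k = cohomologyMap R f k ∘ₗ cohomologyMap R g k := by
  ext a
  rfl

theorem cohomologyMap_unit (f : S ⟶ T) : cohomologyMap R f 0 (unit R T) = unit R S := rfl

theorem cochainMap_cochainCup (f : S ⟶ T) {p q n : ℕ} (h : p + q = n) (φ : Cochain R T p)
    (ψ : Cochain R T q) :
    cochainMap R f n (cochainCup h φ ψ) =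
      cochainCup h (cochainMap R f p φ) (cochainMap R f q ψ) := by
  funext σ
  simp only [cochainCup, cochainMap_apply, NatTrans.naturality_apply]

theorem cohomologyMap_cup (f : S ⟶ T) {p q : ℕ} (a : SCohomology R T p) (b : SCohomology R T q) :
    cohomologyMap R f (p + q) (cup a b) = cup (cohomologyMap R f p a) (cohomologyMap R f q b) := by
  obtain ⟨φ, hφ, rfl⟩ := exists_cls_eq a
  obtain ⟨ψ, hψ, rfl⟩ := exists_cls_eq b
  exact congrArg (Submodule.Quotient.mk (p := (coboundaries R S (p + q)).submoduleOf _))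
    (Subtype.ext (cochainMap_cochainCup f rfl φ ψ))

end Functoriality

section Homotopy

variable (R : Type) [CommRing R] {S T : SSet.{0}}

/-- The contravariant functor `X ↦ (X → R)`, viewed as a covariant functor to the opposite category
so that it turns simplicial homotopies of simplicial sets into simplicial homotopies of simplicial
objects, to which the alternating face map complex applies. -/
def functionModule : Type ⥤ (ModuleCat.{0} R)ᵒᵖ where
  obj X := Opposite.op (ModuleCat.of R (X → R))
  map f := (ModuleCat.ofHom (LinearMap.funLeft R R f)).op

theorem alternatingFaceMapComplex_functionModule_d (k : ℕ) (φ : Cochain R S k) :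
    (((AlgebraicTopology.alternatingFaceMapComplex (ModuleCat.{0} R)ᵒᵖ).obj
      (((SimplicialObject.whiskering _ _).obj (functionModule R)).obj S)).d (k + 1) k).unop.hom φ =
      d R S k φ := by
  rw [AlgebraicTopology.alternatingFaceMapComplex_obj_d,
    AlgebraicTopology.AlternatingFaceMapComplex.objD]
  funext σ
  let eval : ((functionModule R).obj (S.obj (.op (.mk (k + 1)))) ⟶
      (functionModule R).obj (S.obj (.op (.mk k)))) →+ R :=
    AddMonoidHom.mk' (fun u => (u.unop.hom : Cochain R S k →ₗ[R] Cochain R S (k + 1)) φ σ)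
      fun _ _ => rfl
  refine (map_sum eval _ _).trans (Finset.sum_congr rfl fun i _ => ?_)
  refine (map_zsmul eval _ _).trans ?_
  rw [zsmul_eq_mul, Int.cast_pow, Int.cast_neg, Int.cast_one]
  rfl

variable {R}

theorem exists_cochain_homotopy {f g : S ⟶ T} (H : SimplicialObject.Homotopy f g) :
    ∃ h : ∀ k, Cochain R T (k + 1) →ₗ[R] Cochain R S k,
      (∀ φ, cochainMap R f 0 φ = h 0 (d R T 0 φ) + cochainMap R g 0 φ) ∧
      ∀ k φ, cochainMap R f (k + 1) φ =
        d R S k (h k φ) + h (k + 1) (d R T (k + 1) φ) + cochainMap R g (k + 1) φ := by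
  let K := (H.whiskerRight (functionModule R)).toChainHomotopy
  refine ⟨fun k => (K.hom k (k + 1)).unop.hom, fun φ => ?_, fun k φ => ?_⟩
  · have hK := K.comm 0
    rw [prevD_eq (j' := 1) (w := by simp), dNext_eq_zero _ _ (by simp), zero_add] at hK
    refine (congrArg (fun u => u.unop.hom φ) hK).trans (congrArg (· + cochainMap R g 0 φ) ?_)
    exact congrArg (K.hom 0 1).unop.hom (alternatingFaceMapComplex_functionModule_d R 0 φ)
  · have hK := K.comm (k + 1)
    rw [dNext_eq (i' := k) (w := by simp), prevD_eq (j' := k + 2) (w := by simp)] at hK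
    refine (congrArg (fun u => u.unop.hom φ) hK).trans
      (congrArg (· + cochainMap R g (k + 1) φ) ?_)
    exact congrArg₂ (· + ·) (alternatingFaceMapComplex_functionModule_d R k _)
      (congrArg (K.hom (k + 1) (k + 2)).unop.hom
        (alternatingFaceMapComplex_functionModule_d R (k + 1) φ))

theorem cohomologyMap_eq_of_homotopy {f g : S ⟶ T} (H : SimplicialObject.Homotopy f g) (k : ℕ) :
    cohomologyMap R f k = cohomologyMap R g k := by
  obtain ⟨h, hzero, hsucc⟩ := exists_cochain_homotopy (R := R) H
  refine LinearMap.ext fun a => ?_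
  obtain ⟨φ, hφ, rfl⟩ := exists_cls_eq a
  rw [cohomologyMap_cls, cohomologyMap_cls, cls_eq_cls]
  cases k with
  | zero =>
    rw [hzero, mem_cocycles.1 hφ, map_zero, zero_add, sub_self]
    exact zero_mem _
  | succ k =>
    rw [hsucc, mem_cocycles.1 hφ, map_zero, add_zero, add_sub_cancel_right]
    exact ⟨_, rfl⟩

end Homotopy

section ContinuousMaps

variable {R : Type} [CommRing R] {X Y Z : Type} [TopologicalSpace X] [TopologicalSpace Y]
  [TopologicalSpace Z]

/-- The map of singular simplicial sets induced by a continuous map. -/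
abbrev singularMap (f : C(X, Y)) :
    TopCat.toSSet.obj (TopCat.of X) ⟶ TopCat.toSSet.obj (TopCat.of Y) :=
  TopCat.toSSet.map (TopCat.ofHom f)

theorem singularMap_id : singularMap (.id X) = 𝟙 _ :=
  TopCat.toSSet.map_id (TopCat.of X)

theorem singularMap_comp (g : C(Y, Z)) (f : C(X, Y)) :
    singularMap (g.comp f) = singularMap f ≫ singularMap g :=
  TopCat.toSSet.map_comp (TopCat.ofHom f) (TopCat.ofHom g)

theorem cohomologyMap_singularMap_eq_of_homotopic {f g : C(X, Y)} (h : f.Homotopic g) (k : ℕ) :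
    cohomologyMap R (singularMap f) k = cohomologyMap R (singularMap g) k := by
  obtain ⟨H⟩ := h
  let H' : TopCat.Homotopy (TopCat.ofHom f) (TopCat.ofHom g) := H
  exact cohomologyMap_eq_of_homotopy H'.toSSet.toSimplicialObjectHomotopy k

theorem cohomologyMap_singularMap_of_homotopic_id {f : C(X, X)} (h : f.Homotopic (.id X)) (k : ℕ) :
    cohomologyMap R (singularMap f) k = LinearMap.id := by
  rw [cohomologyMap_singularMap_eq_of_homotopic h, singularMap_id, cohomologyMap_id]

theorem bijective_cohomologyMap_of_homotopyEquiv (e : ContinuousMap.HomotopyEquiv X Y) (k : ℕ) :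
    Function.Bijective (cohomologyMap R (singularMap e.toFun) k) := by
  refine Function.bijective_iff_has_inverse.2
    ⟨cohomologyMap R (singularMap e.invFun) k, fun a => ?_, fun a => ?_⟩
  · rw [← LinearMap.comp_apply, ← cohomologyMap_comp, ← singularMap_comp,
      cohomologyMap_singularMap_of_homotopic_id e.right_inv, LinearMap.id_apply]
  · rw [← LinearMap.comp_apply, ← cohomologyMap_comp, ← singularMap_comp,
      cohomologyMap_singularMap_of_homotopic_id e.left_inv, LinearMap.id_apply]

end ContinuousMaps

section Transfer

variable {R : Type} [CommRing R] {S T : SSet.{0}} {G : Type} [Group G]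

variable (R) in
/-- The representation on cochains induced by an action `ρ` of `G` on a simplicial set; the inverse
makes up for the contravariance of cochains. -/
def cochainRep (ρ : G →* End S) (k : ℕ) : Representation R G (Cochain R S k) where
  toFun g := cochainMap R (ρ g⁻¹) k
  map_one' := by rw [inv_one, map_one]; rfl
  map_mul' g h := by rw [mul_inv_rev, map_mul]; rfl

theorem cochainRep_apply (ρ : G →* End S) (k : ℕ) (g : G) :
    cochainRep R ρ k g = cochainMap R (ρ g⁻¹) k := rfl

/-- `π` exhibits `T`, simplex by simplex, as the orbit space of the action `ρ` of `G` on `S`. -/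
structure IsOrbitMap (ρ : G →* End S) (π : S ⟶ T) : Prop where
  surjective (k : SimplexCategoryᵒᵖ) : Function.Surjective (π.app k)
  app_eq_app_iff {k : SimplexCategoryᵒᵖ} {σ τ : S.obj k} :
    π.app k σ = π.app k τ ↔ ∃ g, (ρ g).app k σ = τ

variable {ρ : G →* End S} {π : S ⟶ T}

theorem IsOrbitMap.cochainMap_injective (h : IsOrbitMap ρ π) (k : ℕ) :
    Function.Injective (cochainMap R π k) :=
  LinearMap.funLeft_injective_of_surjective R R _ (h.surjective _)

theorem IsOrbitMap.range_cochainMap (h : IsOrbitMap ρ π) (k : ℕ) :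
    LinearMap.range (cochainMap R π k) = (cochainRep R ρ k).invariants := by
  ext φ
  constructor
  · rintro ⟨θ, rfl⟩ g
    funext σ
    exact congrArg θ (h.app_eq_app_iff.2 ⟨g⁻¹, rfl⟩).symm
  · intro hφ
    refine ⟨fun τ => φ (Function.surjInv (h.surjective _) τ), funext fun σ => ?_⟩
    obtain ⟨g, hg⟩ := h.app_eq_app_iff.1 (Function.surjInv_eq (h.surjective _) (π.app _ σ)).symm
    have hinv := congrFun (hφ g⁻¹) σ
    rw [cochainRep_apply, inv_inv, cochainMap_apply, hg] at hinv
    exact hinv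

theorem IsOrbitMap.cochainMap_mem_cocycles_iff (h : IsOrbitMap ρ π) {k : ℕ} {φ : Cochain R T k} :
    cochainMap R π k φ ∈ cocycles R S k ↔ φ ∈ cocycles R T k := by
  rw [mem_cocycles, mem_cocycles, d_cochainMap, map_eq_zero_iff _ (h.cochainMap_injective _)]

variable [Fintype G] [Invertible (Fintype.card G : R)]

theorem averageMap_cochainRep (k : ℕ) (φ : Cochain R S k) :
    (cochainRep R ρ k).averageMap φ =
      ⅟(Fintype.card G : R) • ∑ g, cochainMap R (ρ g⁻¹) k φ := by
  simp [Representation.averageMap, GroupAlgebra.average, cochainRep_apply]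

theorem d_averageMap (k : ℕ) (φ : Cochain R S k) :
    d R S k ((cochainRep R ρ k).averageMap φ) =
      (cochainRep R ρ (k + 1)).averageMap (d R S k φ) := by
  simp only [averageMap_cochainRep, map_smul, map_sum, d_cochainMap]

theorem averageMap_mem_cocycles {k : ℕ} {φ : Cochain R S k} (hφ : φ ∈ cocycles R S k) :
    (cochainRep R ρ k).averageMap φ ∈ cocycles R S k := by
  rw [mem_cocycles, d_averageMap, mem_cocycles.1 hφ, map_zero]

theorem averageMap_sub_mem_coboundaries {k : ℕ}
    (htriv : ∀ g, cohomologyMap R (ρ g) k = LinearMap.id) {φ : Cochain R S k}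
    (hφ : φ ∈ cocycles R S k) :
    (cochainRep R ρ k).averageMap φ - φ ∈ coboundaries R S k := by
  have hsum : (cochainRep R ρ k).averageMap φ - φ =
      ⅟(Fintype.card G : R) • ∑ g, (cochainMap R (ρ g⁻¹) k φ - φ) := by
    rw [averageMap_cochainRep, Finset.sum_sub_distrib, smul_sub, Finset.sum_const,
      Finset.card_univ, ← Nat.cast_smul_eq_nsmul R, smul_smul, invOf_mul_self, one_smul]
  rw [hsum]
  refine Submodule.smul_mem _ _ (Submodule.sum_mem _ fun g _ => ?_)
  rw [← cls_eq_cls (cochainMap_mem_cocycles _ hφ) hφ, ← cohomologyMap_cls, htriv,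
    LinearMap.id_apply]

/-- If a cochain of the base pulls back to `dψ`, it is the coboundary of the cochain that pulls
back to the average of `ψ`. -/
theorem IsOrbitMap.mem_coboundaries_of_cochainMap_mem (h : IsOrbitMap ρ π) :
    ∀ {k : ℕ} {φ : Cochain R T k}, cochainMap R π k φ ∈ coboundaries R S k →
      φ ∈ coboundaries R T k
  | 0, φ, hφ =>
    (map_eq_zero_iff _ (h.cochainMap_injective 0)).1 ((Submodule.mem_bot R).1 hφ) ▸ zero_mem _
  | k + 1, φ, ⟨ψ, hψ⟩ => by
    have hinv : cochainMap R π (k + 1) φ ∈ (cochainRep R ρ (k + 1)).invariants :=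
      h.range_cochainMap (R := R) _ ▸ ⟨φ, rfl⟩
    obtain ⟨θ, hθ⟩ : (cochainRep R ρ k).averageMap ψ ∈ LinearMap.range (cochainMap R π k) :=
      h.range_cochainMap (R := R) _ ▸ Representation.averageMap_invariant _ ψ
    refine ⟨θ, h.cochainMap_injective _ ?_⟩
    rw [← d_cochainMap, hθ, d_averageMap, hψ, Representation.averageMap_id _ _ hinv]

theorem IsOrbitMap.cohomologyMap_injective (h : IsOrbitMap ρ π) (k : ℕ) :
    Function.Injective (cohomologyMap R π k) := by
  refine (injective_iff_map_eq_zero _).2 fun a ha => ?_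
  obtain ⟨φ, hφ, rfl⟩ := exists_cls_eq a
  rw [cohomologyMap_cls, cls_eq_zero] at ha
  exact (cls_eq_zero hφ).2 (h.mem_coboundaries_of_cochainMap_mem ha)

theorem IsOrbitMap.cohomologyMap_surjective (h : IsOrbitMap ρ π) {k : ℕ}
    (htriv : ∀ g, cohomologyMap R (ρ g) k = LinearMap.id) :
    Function.Surjective (cohomologyMap R π k) := by
  intro a
  obtain ⟨ψ, hψ, rfl⟩ := exists_cls_eq a
  obtain ⟨φ, hφ⟩ : (cochainRep R ρ k).averageMap ψ ∈ LinearMap.range (cochainMap R π k) :=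
    h.range_cochainMap (R := R) _ ▸ Representation.averageMap_invariant _ ψ
  have hφ_cocycle : φ ∈ cocycles R T k :=
    h.cochainMap_mem_cocycles_iff.1 (hφ ▸ averageMap_mem_cocycles hψ)
  refine ⟨cls φ hφ_cocycle, ?_⟩
  rw [cohomologyMap_cls, cls_eq_cls, hφ]
  exact averageMap_sub_mem_coboundaries htriv hψ

end Transfer

section Coverings

variable {R : Type} [CommRing R] {X Y : Type} [TopologicalSpace X] [TopologicalSpace Y]

theorem toSSetObjEquiv_singularMap (f : C(X, Y)) (k : SimplexCategoryᵒᵖ)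
    (σ : (TopCat.toSSet.obj (TopCat.of X)).obj k) :
    TopCat.toSSetObjEquiv _ k ((singularMap f).app k σ) =
      f.comp (TopCat.toSSetObjEquiv (TopCat.of X) k σ) := rfl

instance (m : ℕ) : ContractibleSpace (stdSimplex ℝ (Fin (m + 1))) :=
  (convex_stdSimplex ℝ _).contractibleSpace ⟨_, (stdSimplex.vertex 0).2⟩

instance (m : ℕ) : LocallyPathConnectedSpace (stdSimplex ℝ (Fin (m + 1))) :=
  (convex_stdSimplex ℝ _).locallyPathConnectedSpace

variable {G : Type} [Group G] [MulAction G X] [ContinuousConstSMul G X]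

/-- Translation by a group element, as a continuous map. -/
def smulMap (g : G) : C(X, X) := ⟨(g • ·), continuous_const_smul g⟩

variable (X G) in
/-- The action of `G` on the singular simplicial set of a `G`-space. -/
def singularAction : G →* End (TopCat.toSSet.obj (TopCat.of X)) where
  toFun g := singularMap (smulMap g)
  map_one' := by
    rw [show smulMap (1 : G) = .id X from ContinuousMap.ext (one_smul G), singularMap_id]
    rfl
  map_mul' g h := by
    rw [show smulMap (g * h) = (smulMap g).comp (smulMap h : C(X, X)) from
      ContinuousMap.ext (mul_smul g h), singularMap_comp]
    rfl

theorem comp_eq_comp_iff_exists_smul {A : Type} [TopologicalSpace A] [PreconnectedSpace A]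
    [Nonempty A] {p : C(X, Y)} (hp : IsQuotientCoveringMap p G) {σ τ : C(A, X)} :
    p.comp σ = p.comp τ ↔ ∃ g : G, (smulMap g).comp σ = τ := by
  constructor
  · intro h
    let a : A := Classical.arbitrary A
    obtain ⟨g, hg⟩ := hp.apply_eq_iff_mem_orbit.1 (DFunLike.congr_fun h a).symm
    refine ⟨g, DFunLike.coe_injective (hp.isCoveringMap.eq_of_comp_eq (ContinuousMap.continuous _)
      (ContinuousMap.continuous _) (funext fun x => ?_) a hg)⟩
    exact (hp.map_smul g).trans (DFunLike.congr_fun h x)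
  · rintro ⟨g, rfl⟩
    exact ContinuousMap.ext fun x => (hp.map_smul g).symm

theorem isOrbitMap_singularMap {p : C(X, Y)} (hp : IsQuotientCoveringMap p G) :
    IsOrbitMap (singularAction X G) (singularMap p) where
  surjective k σ := by
    let e := TopCat.toSSetObjEquiv (TopCat.of X) k
    obtain ⟨x, hx⟩ := hp.surjective (TopCat.toSSetObjEquiv _ k σ (stdSimplex.vertex 0))
    obtain ⟨τ, ⟨-, hτ⟩, -⟩ := hp.isCoveringMap.existsUnique_continuousMap_lifts _ _ x hx
    exact ⟨e.symm τ, (TopCat.toSSetObjEquiv _ k).injective (DFunLike.coe_injective hτ)⟩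
  app_eq_app_iff {k σ τ} := by
    let e := TopCat.toSSetObjEquiv (TopCat.of X) k
    have hcomp : p.comp (e σ) = p.comp (e τ) ↔ ∃ g : G, (smulMap g).comp (e σ) = e τ :=
      comp_eq_comp_iff_exists_smul hp
    rw [← (TopCat.toSSetObjEquiv _ k).injective.eq_iff, toSSetObjEquiv_singularMap,
      toSSetObjEquiv_singularMap, hcomp]
    exact exists_congr fun g => e.injective.eq_iff (a := (singularMap (smulMap g)).app k σ)

theorem bijective_cohomologyMap_of_isQuotientCoveringMap [Fintype G]
    [Invertible (Fintype.card G : R)] {p : C(X, Y)} (hp : IsQuotientCoveringMap p G)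
    (hid : ∀ g : G, (smulMap g : C(X, X)).Homotopic (.id X)) (k : ℕ) :
    Function.Bijective (cohomologyMap R (singularMap p) k) :=
  have h := isOrbitMap_singularMap hp
  ⟨h.cohomologyMap_injective k, h.cohomologyMap_surjective fun g =>
    cohomologyMap_singularMap_of_homotopic_id (hid g) k⟩

end Coverings

end SingularCohomology

section GramSchmidt

open InnerProductSpace

variable {𝕜 ι E : Type*} [RCLike 𝕜] [LinearOrder ι] [LocallyFiniteOrderBot ι] [WellFoundedLT ι]
  [NormedAddCommGroup E] [InnerProductSpace 𝕜 E]

theorem inner_gramSchmidt_self (f : ι → E) (j : ι) :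
    inner 𝕜 (gramSchmidt 𝕜 f j) (f j) = (‖gramSchmidt 𝕜 f j‖ : 𝕜) ^ 2 := by
  conv_lhs => rw [gramSchmidt_def'' 𝕜 f j]
  rw [inner_add_right, inner_sum, Finset.sum_eq_zero, add_zero, inner_self_eq_norm_sq_to_K]
  intro i hi
  rw [inner_smul_right, gramSchmidt_orthogonal 𝕜 f (Finset.mem_Iio.1 hi).ne', mul_zero]

variable {A : Type*} [TopologicalSpace A] {f : A → ι → E}

theorem continuous_gramSchmidt (hf : ∀ i, Continuous fun a => f a i)
    (hli : ∀ a, LinearIndependent 𝕜 (f a)) (j : ι) :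
    Continuous fun a => gramSchmidt 𝕜 (f a) j := by
  induction j using WellFoundedLT.induction with
  | ind j ih =>
    simp only [gramSchmidt_def 𝕜 (f _) j, Submodule.starProjection_singleton]
    refine (hf j).sub (continuous_finsetSum _ fun i hi => ?_)
    have hcont := ih i (Finset.mem_Iio.1 hi)
    refine ((hcont.inner (hf j)).div ?_ fun a => ?_).smul hcont
    · exact RCLike.continuous_ofReal.comp (hcont.norm.pow 2)
    · simpa using gramSchmidt_ne_zero i (hli a)

theorem continuous_gramSchmidtNormed (hf : ∀ i, Continuous fun a => f a i)
    (hli : ∀ a, LinearIndependent 𝕜 (f a)) (j : ι) :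
    Continuous fun a => gramSchmidtNormed 𝕜 (f a) j := by
  have hcont := continuous_gramSchmidt hf hli j
  refine Continuous.smul ((RCLike.continuous_ofReal.comp hcont.norm).inv₀ fun a => ?_) hcont
  simpa using gramSchmidt_ne_zero j (hli a)

end GramSchmidt

theorem det_pos_of_isUpperTriangular {ι R : Type*} [Fintype ι] [LinearOrder ι]
    [CommRing R] [PartialOrder R] [IsStrictOrderedRing R] {M : Matrix ι ι R}
    (hM : M.IsUpperTriangular) (hdiag : ∀ i, 0 < M i i) : 0 < M.det := by
  rw [Matrix.det_of_isUpperTriangular hM]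
  exact Finset.prod_pos fun i _ => hdiag i

section SpecialOrthogonalGroup

variable {ι : Type*} [Fintype ι] [DecidableEq ι]

/-- An orthogonal matrix as a linear isometry of Euclidean space. -/
def orthogonalGroupEquiv :
    Matrix.orthogonalGroup ι ℝ ≃* (EuclideanSpace ℝ ι ≃ₗᵢ[ℝ] EuclideanSpace ℝ ι) :=
  (Unitary.mapEquiv ⟨MulEquivClass.toMulEquiv (Matrix.toEuclideanCLM (n := ι) (𝕜 := ℝ)),
    map_star _⟩).toMulEquiv.trans Unitary.linearIsometryEquiv

theorem toLp_mulVec_eq_orthogonalGroupEquiv (A : Matrix.orthogonalGroup ι ℝ)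
    (x : EuclideanSpace ℝ ι) : orthogonalGroupEquiv A x = WithLp.toLp 2 (A.1.mulVec x.ofLp) :=
  rfl

theorem det_orthogonalGroupEquiv_symm (e : EuclideanSpace ℝ ι ≃ₗᵢ[ℝ] EuclideanSpace ℝ ι) :
    (orthogonalGroupEquiv.symm e).1.det = LinearMap.det (e : EuclideanSpace ℝ ι →ₗ[ℝ] _) := by
  obtain ⟨A, rfl⟩ := orthogonalGroupEquiv.surjective e
  rw [MulEquiv.symm_apply_apply, ← LinearMap.det_toLin (EuclideanSpace.basisFun ι ℝ).toBasis]
  congr 1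

/-- The orthogonal matrix of the reflection in the hyperplane orthogonal to `v`
(the identity matrix for `v = 0`). -/
def householder (v : EuclideanSpace ℝ ι) : Matrix.orthogonalGroup ι ℝ :=
  orthogonalGroupEquiv.symm (ℝ ∙ v)ᗮ.reflection

theorem householder_mul_self (v : EuclideanSpace ℝ ι) : householder v * householder v = 1 := by
  rw [householder, ← map_mul, Submodule.reflection_mul_reflection, map_one]

theorem householder_apply (v : EuclideanSpace ℝ ι) (i j : ι) :
    (householder v).1 i j = (1 : Matrix ι ι ℝ) i j - 2 * (v j / ‖v‖ ^ 2) * v i := by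
  have h : (householder v).1 i j = orthogonalGroupEquiv (householder v) (.single j 1) i := by
    simp [toLp_mulVec_eq_orthogonalGroupEquiv]
  rw [h, householder, MulEquiv.apply_symm_apply, Submodule.reflection_orthogonal_apply,
    Submodule.reflection_singleton_apply]
  simp only [EuclideanSpace.inner_single_right, Real.ringHom_apply, one_mul, neg_sub,
    PiLp.sub_apply, PiLp.single_apply, PiLp.smul_apply, smul_eq_mul, nsmul_eq_mul,
    Nat.cast_ofNat, Matrix.one_apply, sub_right_inj]
  ring

theorem householder_zero : householder (0 : EuclideanSpace ℝ ι) = 1 := by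
  ext i j
  simp [householder_apply]

theorem householder_neg (v : EuclideanSpace ℝ ι) : householder (-v) = householder v := by
  simp only [householder, ← Set.neg_singleton, Submodule.span_neg]

theorem det_householder {v : EuclideanSpace ℝ ι} (hv : v ≠ 0) : (householder v).1.det = -1 := by
  rw [householder, det_orthogonalGroupEquiv_symm]
  refine (Submodule.det_reflection _).trans ?_
  rw [Submodule.orthogonal_orthogonal, finrank_span_singleton hv, pow_one]

theorem continuousOn_householder :
    ContinuousOn (householder : EuclideanSpace ℝ ι → Matrix.orthogonalGroup ι ℝ) {0}ᶜ := by
  refine Topology.IsInducing.subtypeVal.continuousOn_iff.2 <|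
    continuousOn_pi.2 fun i => continuousOn_pi.2 fun j => ?_
  simp only [Function.comp_apply, householder_apply]
  fun_prop (disch := simp)

theorem joined_householder {v w : EuclideanSpace ℝ ι} (hv : v ≠ 0) (hw : w ≠ 0) :
    Joined (householder v) (householder w) := by
  wlog hvw : 0 ≤ inner ℝ v w generalizing w
  · rw [← householder_neg w]
    exact this (neg_ne_zero.2 hw) (by rw [inner_neg_right]; linarith)
  have hsegment : ∀ t : unitInterval, AffineMap.lineMap v w (t : ℝ) ≠ 0 := fun t ht => by
    have hinner : (1 - t.1) * ‖v‖ ^ 2 + t.1 * inner ℝ v w = 0 := by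
      simpa [AffineMap.lineMap_apply_module, inner_add_right, inner_smul_right]
        using congrArg (inner ℝ v) ht
    have ht1 : t.1 = 1 := by
      by_contra hne
      have hpos := mul_pos (sub_pos.2 (t.2.2.lt_of_ne hne)) (pow_pos (norm_pos_iff.2 hv) 2)
      linarith only [hinner, hpos, mul_nonneg t.2.1 hvw]
    exact hw (by simpa [ht1] using ht)
  exact ⟨⟨⟨fun t => householder (AffineMap.lineMap v w (t : ℝ)),
    continuousOn_householder.comp_continuous (by fun_prop) hsegment⟩, by simp, by simp⟩⟩

theorem exists_eq_prod_householder (A : Matrix.orthogonalGroup ι ℝ) :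
    ∃ l : List (EuclideanSpace ℝ ι), A = (l.map householder).prod := by
  obtain ⟨l, -, hl⟩ := (orthogonalGroupEquiv A).reflections_generate_dim
  refine ⟨l, orthogonalGroupEquiv.injective ?_⟩
  simp only [hl, map_list_prod, List.map_map, Function.comp_def, householder,
    MulEquiv.apply_symm_apply]

theorem joined_one_or_joined_householder (A : Matrix.orthogonalGroup ι ℝ) :
    Joined A 1 ∨ ∃ v : EuclideanSpace ℝ ι, v ≠ 0 ∧ Joined A (householder v) := by
  obtain ⟨l, rfl⟩ := exists_eq_prod_householder A
  induction l with
  | nil => exact .inl (.refl 1)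
  | cons v l ih =>
    rw [List.map_cons, List.prod_cons]
    obtain rfl | hv := eq_or_ne v 0
    · rwa [householder_zero, one_mul]
    obtain hl | ⟨w, hw, hl⟩ := ih
    · exact .inr ⟨v, hv, by simpa only [mul_one] using (Joined.refl (householder v)).mul hl⟩
    · exact .inl (householder_mul_self w ▸ (joined_householder hv hw).mul hl)

theorem det_eq_of_joined {A B : Matrix.orthogonalGroup ι ℝ} (h : Joined A B) :
    A.1.det = B.1.det := by
  obtain ⟨γ⟩ := h
  have hcont : Continuous fun t => (γ t).1.det :=
    (continuous_subtype_val.comp γ.continuous).matrix_det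
  have hsq : ∀ t, (γ t).1.det ^ 2 = 1 := fun t => by
    have h := congrArg Matrix.det ((Matrix.mem_orthogonalGroup_iff ι ℝ).1 (γ t).2)
    rwa [Matrix.det_mul, Matrix.det_transpose, Matrix.det_one, ← sq] at h
  obtain h | h := isPreconnected_univ.eq_one_or_eq_neg_one_of_sq_eq hcont.continuousOn
    fun t _ => hsq t
  all_goals
    have h0 := h (Set.mem_univ 0)
    have h1 := h (Set.mem_univ 1)
    simp only [γ.source, γ.target] at h0 h1
    exact h0.trans h1.symm

theorem joined_one_of_det_eq_one {A : Matrix.orthogonalGroup ι ℝ} (hA : A.1.det = 1) :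
    Joined A 1 := by
  refine (joined_one_or_joined_householder A).resolve_right fun ⟨v, hv, h⟩ => ?_
  have hdet := det_eq_of_joined h
  rw [hA, det_householder hv] at hdet
  norm_num at hdet

theorem pathComponent_one_orthogonalGroup :
    pathComponent (1 : Matrix.orthogonalGroup ι ℝ) = {A | A.1.det = 1} :=
  Set.ext fun _ => ⟨fun h => (det_eq_of_joined h).symm.trans Matrix.det_one,
    fun h => (joined_one_of_det_eq_one h).symm⟩

end SpecialOrthogonalGroup

namespace UnitColumns

section Columns

variable {m ι : Type*}

/-- The columns of a matrix as vectors of Euclidean space. -/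
def cols (B : Matrix m ι ℝ) (j : ι) : EuclideanSpace ℝ m :=
  WithLp.toLp 2 (B.col j)

theorem continuous_cols (j : ι) : Continuous fun B : Matrix m ι ℝ => cols B j :=
  (PiLp.continuous_toLp 2 _).comp (continuous_pi fun i => continuous_id.matrix_elem i j)

variable [Fintype m]

theorem transpose_mul_apply_eq_inner (M N : Matrix m ι ℝ) (i j : ι) :
    (M.transpose * N) i j = inner ℝ (cols M i) (cols N j) := by
  simp [Matrix.mul_apply, cols, PiLp.inner_apply, mul_comm]

/-- The matrix obtained by rescaling the columns to unit length. -/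
def normalizeCols (B : Matrix m ι ℝ) : Matrix m ι ℝ :=
  .of fun i j => ‖cols B j‖⁻¹ * B i j

theorem cols_normalizeCols (B : Matrix m ι ℝ) (j : ι) :
    cols (normalizeCols B) j = ‖cols B j‖⁻¹ • cols B j := rfl

theorem normalizeCols_eq_self {B : Matrix m ι ℝ} (hB : ∀ j, ‖cols B j‖ = 1) :
    normalizeCols B = B := by
  ext i j
  rw [normalizeCols, Matrix.of_apply, hB, inv_one, one_mul]

variable [Fintype ι] [DecidableEq ι]

theorem linearIndependent_cols {B : Matrix ι ι ℝ} (hB : B.det ≠ 0) :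
    LinearIndependent ℝ (cols B) :=
  (Matrix.linearIndependent_cols_of_det_ne_zero hB).map'
    (WithLp.linearEquiv 2 ℝ (ι → ℝ)).symm.toLinearMap (LinearEquiv.ker _)

theorem norm_cols_pos {B : Matrix ι ι ℝ} (hB : B.det ≠ 0) (j : ι) : 0 < ‖cols B j‖ :=
  norm_pos_iff.2 ((linearIndependent_cols hB).ne_zero j)

theorem norm_cols_of_mem_orthogonalGroup {A : Matrix ι ι ℝ}
    (hA : A ∈ Matrix.orthogonalGroup ι ℝ) (j : ι) : ‖cols A j‖ = 1 := by
  have h := congrFun₂ ((Matrix.mem_orthogonalGroup_iff' _ _).1 hA) j j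
  rw [transpose_mul_apply_eq_inner, Matrix.one_apply_eq, real_inner_self_eq_norm_sq] at h
  exact (pow_eq_one_iff_of_nonneg (norm_nonneg _) two_ne_zero).1 h

theorem det_normalizeCols_pos {B : Matrix ι ι ℝ} (hB : 0 < B.det) :
    0 < (normalizeCols B).det := by
  rw [normalizeCols, Matrix.det_mul_row]
  exact mul_pos (Finset.prod_pos fun j _ => inv_pos.2 (norm_cols_pos hB.ne' j)) hB

theorem continuousOn_normalizeCols :
    ContinuousOn (normalizeCols (m := ι) (ι := ι)) {B | B.det ≠ 0} := by
  refine continuousOn_pi.2 fun i => continuousOn_pi.2 fun j => ?_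
  exact ((continuous_cols j).norm.continuousOn.inv₀ fun B hB => (norm_cols_pos hB j).ne').mul
    (continuous_id.matrix_elem i j).continuousOn

end Columns

section Orthonormalization

open InnerProductSpace

variable {ι : Type*} [Fintype ι] [LinearOrder ι] [LocallyFiniteOrderBot ι]

/-- The matrix whose columns are obtained from those of `B` by the Gram–Schmidt process. -/
def orthonormalize (B : Matrix ι ι ℝ) : Matrix ι ι ℝ :=
  .of fun i j => gramSchmidtNormed ℝ (cols B) j i

theorem cols_orthonormalize (B : Matrix ι ι ℝ) (j : ι) :
    cols (orthonormalize B) j = gramSchmidtNormed ℝ (cols B) j := rfl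

theorem orthonormalize_mem_orthogonalGroup {B : Matrix ι ι ℝ} (hB : B.det ≠ 0) :
    orthonormalize B ∈ Matrix.orthogonalGroup ι ℝ := by
  rw [Matrix.mem_orthogonalGroup_iff']
  ext i j
  rw [transpose_mul_apply_eq_inner, cols_orthonormalize, cols_orthonormalize, Matrix.one_apply]
  have h : Orthonormal ℝ (gramSchmidtNormed ℝ (cols B)) :=
    gramSchmidtNormed_orthonormal (linearIndependent_cols hB)
  exact orthonormal_iff_ite.1 h i j

theorem isUpperTriangular_transpose_orthonormalize_mul (B : Matrix ι ι ℝ) :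
    ((orthonormalize B).transpose * B).IsUpperTriangular := by
  intro i j (hij : j < i)
  rw [transpose_mul_apply_eq_inner, cols_orthonormalize, gramSchmidtNormed, inner_smul_left,
    gramSchmidt_inv_triangular ℝ _ hij, mul_zero]

theorem transpose_orthonormalize_mul_diag_pos {B : Matrix ι ι ℝ} (hB : B.det ≠ 0) (j : ι) :
    0 < ((orthonormalize B).transpose * B) j j := by
  have hpos := norm_pos_iff.2 (gramSchmidt_ne_zero j (linearIndependent_cols hB))
  rw [transpose_mul_apply_eq_inner, cols_orthonormalize, gramSchmidtNormed, inner_smul_left,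
    inner_gramSchmidt_self]
  simp only [map_inv₀, RCLike.ofReal_real_eq_id, id, conj_trivial]
  exact mul_pos (inv_pos.2 hpos) (pow_pos hpos 2)

theorem det_orthonormalize {B : Matrix ι ι ℝ} (hB : 0 < B.det) : (orthonormalize B).det = 1 := by
  have hprod := det_pos_of_isUpperTriangular (isUpperTriangular_transpose_orthonormalize_mul B)
    (transpose_orthonormalize_mul_diag_pos hB.ne')
  have hsq := congrArg Matrix.det
    ((Matrix.mem_orthogonalGroup_iff' _ _).1 (orthonormalize_mem_orthogonalGroup hB.ne'))
  rw [Matrix.det_mul, Matrix.det_transpose] at hprod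
  rw [Matrix.det_mul, Matrix.det_transpose, Matrix.det_one] at hsq
  have hpos : 0 < (orthonormalize B).det := pos_of_mul_pos_left hprod hB.le
  exact (mul_self_eq_one_iff.1 hsq).resolve_right (neg_one_lt_zero.trans hpos).ne'

theorem orthonormalize_mem_specialOrthogonalGroup {B : Matrix ι ι ℝ} (hB : 0 < B.det) :
    orthonormalize B ∈ Matrix.specialOrthogonalGroup ι ℝ :=
  Matrix.mem_specialOrthogonalGroup_iff.2
    ⟨orthonormalize_mem_orthogonalGroup hB.ne', det_orthonormalize hB⟩

theorem orthonormalize_eq_self {A : Matrix ι ι ℝ} (hA : A ∈ Matrix.orthogonalGroup ι ℝ) :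
    orthonormalize A = A := by
  have hgs : gramSchmidt ℝ (cols A) = cols A := gramSchmidt_of_orthogonal ℝ fun i j hij => by
    beta_reduce
    rw [← transpose_mul_apply_eq_inner, (Matrix.mem_orthogonalGroup_iff' _ _).1 hA,
      Matrix.one_apply_ne hij]
  ext i j
  have hij : gramSchmidtNormed ℝ (cols A) j = cols A j := by
    simp only [gramSchmidtNormed, hgs, norm_cols_of_mem_orthogonalGroup hA, inv_one,
      RCLike.ofReal_one, one_smul]
  exact congrArg (· i) hij

/-- Multiplication by the transpose of the orthogonal matrix moves the segment to one from an upper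
triangular matrix with positive diagonal to the identity. -/
theorem det_lineMap_orthonormalize_pos {B : Matrix ι ι ℝ} (hB : 0 < B.det) {t : ℝ}
    (ht : t ∈ unitInterval) : 0 < (AffineMap.lineMap B (orthonormalize B) t).det := by
  set Q := orthonormalize B with hQ
  have hQQ : Q.transpose * Q = 1 :=
    (Matrix.mem_orthogonalGroup_iff' _ _).1 (orthonormalize_mem_orthogonalGroup hB.ne')
  have hmul : Q.transpose * AffineMap.lineMap B Q t =
      (1 - t) • (Q.transpose * B) + t • 1 := by
    rw [AffineMap.lineMap_apply_module, mul_add, mul_smul_comm, mul_smul_comm, hQQ]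
  have hpos : 0 < (Q.transpose * AffineMap.lineMap B Q t).det := by
    rw [hmul]
    refine det_pos_of_isUpperTriangular (fun i j (hij : j < i) => ?_) fun j => ?_
    · have hzero : (Q.transpose * B) i j = 0 :=
        isUpperTriangular_transpose_orthonormalize_mul B hij
      simp [hzero, Matrix.one_apply_ne hij.ne']
    · have hdiag := transpose_orthonormalize_mul_diag_pos hB.ne' j
      rw [Matrix.add_apply, Matrix.smul_apply, Matrix.smul_apply, Matrix.one_apply_eq]
      exact convex_Ioi (0 : ℝ) hdiag (Set.mem_Ioi.2 one_pos) (sub_nonneg.2 ht.2) ht.1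
        (sub_add_cancel 1 t)
  rwa [Matrix.det_mul, Matrix.det_transpose, hQ, det_orthonormalize hB, one_mul] at hpos

theorem continuousOn_orthonormalize :
    ContinuousOn (orthonormalize (ι := ι)) {B | B.det ≠ 0} := by
  rw [continuousOn_iff_continuous_domRestrict]
  have hli (B : {B : Matrix ι ι ℝ | B.det ≠ 0}) : LinearIndependent ℝ (cols B.1) :=
    linearIndependent_cols B.2
  have hcols (j : ι) : Continuous fun B : {B : Matrix ι ι ℝ | B.det ≠ 0} =>
      gramSchmidtNormed ℝ (cols B.1) j :=
    continuous_gramSchmidtNormed (fun k => (continuous_cols k).comp continuous_subtype_val) hli j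
  exact continuous_matrix fun i j => (PiLp.continuous_apply 2 _ i).comp (hcols j)

end Orthonormalization

section Retraction

variable {n : ℕ}

/-- The normalised matrix of positive determinant, as a point of `W(n)_{>0}`. -/
def normalize : C({B : Matrix (Fin n) (Fin n) ℝ // 0 < B.det}, WPos n) where
  toFun B := ⟨normalizeCols B.1, fun j => by
    change ‖cols (normalizeCols B.1) j‖ = 1
    rw [cols_normalizeCols, norm_smul, norm_inv, norm_norm,
      inv_mul_cancel₀ (norm_cols_pos B.2.ne' j).ne'], det_normalizeCols_pos B.2⟩
  continuous_toFun := (continuousOn_normalizeCols.comp_continuous continuous_subtype_val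
    fun B => B.2.ne').subtype_mk _

theorem normalize_of_mem_W {B : {B : Matrix (Fin n) (Fin n) ℝ // 0 < B.det}} (hB : B.1 ∈ W n) :
    (normalize B).1 = B.1 :=
  normalizeCols_eq_self hB

theorem homotopic_of_homotopy_det_pos {X : Type*} [TopologicalSpace X] {f g : C(X, WPos n)}
    (H : C(unitInterval × X, {B : Matrix (Fin n) (Fin n) ℝ // 0 < B.det}))
    (hzero : ∀ x, (H (0, x)).1 = (f x).1) (hone : ∀ x, (H (1, x)).1 = (g x).1) :
    f.Homotopic g :=
  ⟨⟨normalize.comp H,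
    fun x => Subtype.ext <| (normalize_of_mem_W (hzero x ▸ (f x).2.1)).trans (hzero x),
    fun x => Subtype.ext <| (normalize_of_mem_W (hone x ▸ (g x).2.1)).trans (hone x)⟩⟩

/-- The inclusion of the special orthogonal group into `W(n)_{>0}`. -/
def incl : C(Matrix.specialOrthogonalGroup (Fin n) ℝ, WPos n) where
  toFun A := ⟨A.1, norm_cols_of_mem_orthogonalGroup (Matrix.mem_specialOrthogonalGroup_iff.1 A.2).1,
    (Matrix.mem_specialOrthogonalGroup_iff.1 A.2).2 ▸ one_pos⟩
  continuous_toFun := continuous_subtype_val.subtype_mk _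

/-- The Gram–Schmidt retraction of `W(n)_{>0}` onto the special orthogonal group. -/
def retract : C(WPos n, Matrix.specialOrthogonalGroup (Fin n) ℝ) where
  toFun B := ⟨orthonormalize B.1, orthonormalize_mem_specialOrthogonalGroup B.2.2⟩
  continuous_toFun := (continuousOn_orthonormalize.comp_continuous continuous_subtype_val
    fun B => B.2.2.ne').subtype_mk _

theorem retract_comp_incl : (retract (n := n)).comp incl = .id _ :=
  ContinuousMap.ext fun A => Subtype.ext <|
    orthonormalize_eq_self (Matrix.mem_specialOrthogonalGroup_iff.1 A.2).1

theorem incl_comp_retract_homotopic_id :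
    ((incl (n := n)).comp retract).Homotopic (.id (WPos n)) := by
  let H : C(unitInterval × WPos n, {B : Matrix (Fin n) (Fin n) ℝ // 0 < B.det}) :=
    { toFun x := ⟨AffineMap.lineMap x.2.1 (incl (retract x.2)).1 x.1.1,
        det_lineMap_orthonormalize_pos x.2.2.2 x.1.2⟩
      continuous_toFun := by
        have hproj : Continuous fun x : unitInterval × WPos n => (incl (retract x.2)).1 :=
          continuous_subtype_val.comp ((incl.comp retract).continuous.comp continuous_snd)
        have htime : Continuous fun x : unitInterval × WPos n => x.1.1 := by fun_prop
        simp only [AffineMap.lineMap_apply_module]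
        exact (((continuous_const.sub htime).smul (continuous_subtype_val.comp
          continuous_snd)).add (htime.smul hproj)).subtype_mk _ }
  exact (homotopic_of_homotopy_det_pos H (fun B => AffineMap.lineMap_apply_zero _ _)
    fun B => AffineMap.lineMap_apply_one _ _).symm

/-- The homotopy equivalence of the special orthogonal group with `W(n)_{>0}`. -/
def inclHomotopyEquiv :
    ContinuousMap.HomotopyEquiv (Matrix.specialOrthogonalGroup (Fin n) ℝ) (WPos n) where
  toFun := incl
  invFun := retract
  left_inv := retract_comp_incl ▸ .refl _
  right_inv := incl_comp_retract_homotopic_id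

end Retraction

section OrbitSpace

open SingularCohomology

variable {n : ℕ}

instance : ContinuousConstSMul (G₀ n)ᵐᵒᵖ (WPos n) where
  continuous_const_smul _ := (continuous_subtype_val.mul continuous_const).subtype_mk _

instance : Finite (G₀ n) := by
  refine Set.Finite.to_subtype (Set.Finite.subset (s := Units.val ⁻¹' Set.range
    fun x : (Fin n → ℤˣ) × Equiv.Perm (Fin n) => signedPerm x.1 x.2) ?_ ?_)
  · exact (Set.finite_range _).preimage Units.val_injective.injOn
  · rintro g ⟨⟨a, σ, h⟩, -⟩
    exact ⟨(a, σ), h.symm⟩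

instance : Finite (G₀ n)ᵐᵒᵖ := Finite.of_equiv _ MulOpposite.opEquiv

instance : IsCancelSMul (G₀ n)ᵐᵒᵖ (WPos n) where
  right_cancel' g h B hgh := by
    have hB : IsUnit B.1 := (Matrix.isUnit_iff_isUnit_det _).2 B.2.2.ne'.isUnit
    exact MulOpposite.unop_injective <| Subtype.ext <| Units.ext <|
      hB.mul_left_cancel (congrArg Subtype.val hgh)

theorem isClosed_W : IsClosed (W n) := by
  have hW : W n = ⋂ j, {B | ‖cols B j‖ = 1} := Set.ofPred_forall _
  exact hW ▸ isClosed_iInter fun j =>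
    isClosed_eq (continuous_cols j).norm continuous_const

instance : LocallyCompactSpace (WPos n) := by
  have : LocallyCompactSpace (Matrix (Fin n) (Fin n) ℝ) :=
    inferInstanceAs (LocallyCompactSpace (Fin n → Fin n → ℝ))
  have hdet : IsOpen {B : Matrix (Fin n) (Fin n) ℝ | 0 < B.det} :=
    isOpen_lt continuous_const continuous_id.matrix_det
  exact (isClosed_W.isLocallyClosed.inter hdet.isLocallyClosed).locallyCompactSpace

/-- The projection of `W(n)_{>0}` onto the orbit space `W(n)_{>0} / G₀`. -/
def orbitProj : C(WPos n, WPosQuot n) := ⟨Quotient.mk _, continuous_quotient_mk'⟩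

theorem isQuotientCoveringMap_orbitProj :
    IsQuotientCoveringMap (orbitProj (n := n)) (G₀ n)ᵐᵒᵖ := by
  have : ProperlyDiscontinuousSMul (G₀ n)ᵐᵒᵖ (WPos n) := ⟨fun _ _ => Set.toFinite _⟩
  exact isQuotientCoveringMap_quotientMk_of_properlyDiscontinuousSMul

theorem mem_orthogonalGroup_of_mem_G₀ {g : GL (Fin n) ℝ} (hg : g ∈ G₀ n) :
    g.1 ∈ Matrix.orthogonalGroup (Fin n) ℝ := by
  obtain ⟨⟨a, σ, h⟩, -⟩ := hg
  refine h ▸ mul_mem ?_ ?_ <;> rw [Matrix.mem_orthogonalGroup_iff]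
  · rw [Matrix.diagonal_transpose, Matrix.diagonal_mul_diagonal, ← Matrix.diagonal_one]
    congr! 2 with i
    exact_mod_cast Int.units_coe_mul_self (a i)
  · rw [Matrix.transpose_permMatrix, ← Matrix.permMatrix_mul, inv_mul_cancel, Matrix.permMatrix_one]

theorem det_eq_one_of_mem_G₀ {g : GL (Fin n) ℝ} (hg : g ∈ G₀ n) : g.1.det = 1 :=
  congrArg Units.val (MonoidHom.mem_ker.1 hg.2)

theorem smulMap_homotopic_id (g : (G₀ n)ᵐᵒᵖ) :
    (smulMap g : C(WPos n, WPos n)).Homotopic (.id _) := by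
  let A : Matrix.orthogonalGroup (Fin n) ℝ := ⟨_, mem_orthogonalGroup_of_mem_G₀ g.unop.2⟩
  have hA : A ∈ pathComponent 1 :=
    pathComponent_one_orthogonalGroup.ge (det_eq_one_of_mem_G₀ g.unop.2)
  obtain ⟨γ, hγ⟩ :=
    isPathConnected_pathComponent.joinedIn A hA 1 (mem_pathComponent_self 1)
  have hdet : ∀ x : unitInterval × WPos n, 0 < (x.2.1 * (γ x.1).1).det := fun x => by
    have hγx : (γ x.1).1.det = 1 := pathComponent_one_orthogonalGroup.le (hγ x.1)
    rw [Matrix.det_mul, hγx, mul_one]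
    exact x.2.2.2
  let H : C(unitInterval × WPos n, {B : Matrix (Fin n) (Fin n) ℝ // 0 < B.det}) :=
    { toFun x := ⟨x.2.1 * (γ x.1).1, hdet x⟩
      continuous_toFun := ((continuous_subtype_val.comp continuous_snd).mul
        (continuous_subtype_val.comp (γ.continuous.comp continuous_fst))).subtype_mk hdet }
  refine homotopic_of_homotopy_det_pos H (fun B => ?_) fun B => ?_
  · exact congrArg (B.1 * ·.1) γ.source
  · exact (congrArg (B.1 * ·.1) γ.target).trans (mul_one _)

theorem bijective_cohomologyMap_orbitProj (k : ℕ) :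
    Function.Bijective (cohomologyMap ℚ (singularMap (orbitProj (n := n))) k) := by
  cases nonempty_fintype (G₀ n)ᵐᵒᵖ
  have : Invertible (Fintype.card (G₀ n)ᵐᵒᵖ : ℚ) :=
    invertibleOfNonzero (Nat.cast_ne_zero.2 Fintype.card_ne_zero)
  exact bijective_cohomologyMap_of_isQuotientCoveringMap isQuotientCoveringMap_orbitProj
    smulMap_homotopic_id k

theorem bijective_cohomologyMap_orbitProj_comp_incl (k : ℕ) :
    Function.Bijective (cohomologyMap ℚ (singularMap ((orbitProj (n := n)).comp incl)) k) := by
  rw [singularMap_comp orbitProj incl, cohomologyMap_comp, LinearMap.coe_comp]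
  exact (bijective_cohomologyMap_of_homotopyEquiv inclHomotopyEquiv k).comp
    (bijective_cohomologyMap_orbitProj k)

end OrbitSpace

end UnitColumns

end

theorem mainTheorem9 (n : ℕ) (hn : 1 < n) :
    ∃ e : ∀ k : ℕ, SingularCohomology.RatCohomology (UnitColumns.WPosQuot n) k ≃ₗ[ℚ]
        SingularCohomology.RatCohomology (Matrix.specialOrthogonalGroup (Fin n) ℝ) k,
      e 0 (SingularCohomology.unit _ _) = SingularCohomology.unit _ _ ∧
      ∀ (p q : ℕ) (a : SingularCohomology.RatCohomology (UnitColumns.WPosQuot n) p)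
        (b : SingularCohomology.RatCohomology (UnitColumns.WPosQuot n) q),
        e (p + q) (SingularCohomology.cup a b) = SingularCohomology.cup (e p a) (e q b) :=
  ⟨fun k => LinearEquiv.ofBijective _ (UnitColumns.bijective_cohomologyMap_orbitProj_comp_incl k),
    SingularCohomology.cohomologyMap_unit _,
    fun _ _ a b => SingularCohomology.cohomologyMap_cup _ a b⟩
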